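/- **Setting.** A linear $[n,k,d]$ code over a field is a $k$-dimensional subspace of the space of vectors of length $n$ with minimum Hamming distance $d$. Let $s\ge 0$ and, for $j\in[s]$, let $m_j\ge 0$, $r_j\ge1$, $\delta_j\ge1$ be integers; put $n_j=m_j(r_j+\delta_j-1)$ and $n=\sum_{j=1}^s n_j$. A linear code $\mathscr C$ of length $n$ has $\{(n_j,r_j,\delta_j)\}_{j\in[s]}$-locality if its symbol index set is a disjoint union $\bigsqcup_{j=1}^s\mathcal N_j$ with $|\mathcal N_j|=n_j$ such that every $i\in\mathcal N_j$ lies in some $\mathcal S_i\subseteq\mathcal N_j$ with $|\mathcal S_i|\le r_j+\delta_j-1$ and $d(\mathscr C|_{\mathcal S_i})\ge\delta_j$, where $\mathscr C|_{\mathcal S_i}$ is the code punctured to the coordinates in $\mathcal S_i$ (the zero code has distance $\infty$). Let $$k_j=\begin{cases}\lfloor\mu_j\rfloor r_j & \text{if } 0\le q_j\le\delta_j-2,\\ n_j-\lceil\mu_j\rceil(\delta_j-1)&\text{if } \delta_j-1\le q_j\le r_j+\delta_j-2,\end{cases}\qquad \mu_j=\frac{n_j}{r_j+\delta_j-1},$$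 where $q_j$ is the remainder of $n_j$ modulo $r_j+\delta_j-1$ (here $\mu_j=m_j$ is an integer, so $q_j=0$ and $k_j=m_jr_j$). **Construction.** Let $\mathbb F_{q^t}/\mathbb F_q$ be an extension of finite fields of degree $t$ and let $1\le k\le n_{\mathrm{Gab}}:=\sum_{j=1}^s m_jr_j\le t$. Encode a message $(a_1,\dots,a_k)\in\mathbb F_{q^t}^k$ as follows: (1) form $f(x)=\sum_{i=1}^k a_ix^{q^{i-1}}$ and evaluate $f$ at $n_{\mathrm{Gab}}$ points of $\mathbb F_{q^t}$ that are linearly independent over $\mathbb F_q$; (2) partition the resulting symbols into $\sum_{j=1}^s m_j$ local groups, $m_j$ of them of size $r_j$ for each $j\in[s]$; (3) encode each local group of size $r_j$ with a generator matrix over $\mathbb F_q$ of an $[r_j+\delta_j-1,r_j,\delta_j]_q$ MDS code. Let $\mathscr C$ be the resulting linear code of length $n$ over $\mathbb F_{q^t}$, and let $\mathcal N_j$ be the set of the $n_j$ symbols coming from the local groups of size $r_j$ that belong to the index $j$. **Theorem.** Suppose that $r_1\le r_2\le\dots\le r_s$ and $\delta_1\ge\delta_2\ge\dots\ge\delta_s$.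 Then, for every choice of the evaluation points and of the local MDS codes, the code $\mathscr C$ has dimension $k$ and $\{(n_j,r_j,\delta_j)\}_{j\in[s]}$-locality with respect to $\mathcal N_1,\dots,\mathcal N_s$, the index $s^*=\min\{j\in[s]\mid\sum_{j'=1}^{j}k_{j'}\ge k\}$ exists, and the minimum distance of $\mathscr C$ is $$d=n-k+1-\sum_{j=1}^{s^*-1}(n_j-k_j)-\left(\left\lceil\frac{k-\sum_{j=1}^{s^*-1}k_j}{r_{s^*}}\right\rceil-1\right)(\delta_{s^*}-1).$$ Moreover $\mathscr C$ is distance optimal: every linear code of length $n$ and dimension $k$ over any finite field that has $\{(n_j,r_j,\delta_j)\}_{j\in[s]}$-locality has minimum distance at most $d$. -/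

import Mathlib

namespace UDLRC

/-! ### Linear codes, minimum distance, puncturing

A linear code of length `|ι|` over `F`, with its coordinates indexed by the finite type `ι`,
is a subspace of `ι → F`; its dimension is `Module.finrank F C`. -/

/-- The minimum Hamming distance of a linear code, i.e. the least Hamming weight of a nonzero
codeword (`⊤` for the zero code, which has no nonzero codeword). -/
noncomputable def minDist {ι F : Type*} [Fintype ι] [Field F] (C : Submodule F (ι → F)) : ℕ∞ :=
  open Classical in ⨅ c ∈ C, ⨅ _ : c ≠ 0, (hammingNorm c : ℕ∞)

/-- The punctured code `C|_S` with support `S`. -/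
def puncture {ι F : Type*} [Field F] (C : Submodule F (ι → F)) (S : Finset ι) :
    Submodule F (S → F) :=
  C.map (LinearMap.funLeft F F (fun i : S => (i : ι)))

/-- The code generated by the rows of a matrix. -/
def rowCode {F : Type*} [Field F] {k n : ℕ} (G : Matrix (Fin k) (Fin n) F) :
    Submodule F (Fin n → F) :=
  Submodule.span F (Set.range G.row)

/-- `G` is a generator matrix of an `[n, k, d]` MDS code: its `k` rows are linearly independent
and the code that they generate meets the Singleton bound `d = n - k + 1`. -/
structure IsMDSGenerator {F : Type*} [Field F] {k n : ℕ} (G : Matrix (Fin k) (Fin n) F) :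
    Prop where
  linearIndependent_rows : LinearIndependent F G.row
  minDist_add : minDist (rowCode G) + (k : ℕ∞) = (n : ℕ∞) + 1

/-! ### Unequal disjoint `(r, δ)`-localities -/

/-- The code `C` has `{(n_j, r_j, δ_j)}`-locality with respect to the partition of its symbol
indices into the classes `N_j = {i | part i = j}`: one has `|N_j| = n_j`, and each `i ∈ N_j` lies in
some `S ⊆ N_j` with `|S| ≤ r_j + δ_j - 1` and `d(C|_S) ≥ δ_j`. -/
structure HasLocality {ι F : Type*} [Fintype ι] [Field F] {s : ℕ} (C : Submodule F (ι → F))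
    (part : ι → Fin s) (n r δ : Fin s → ℕ) : Prop where
  card_class : ∀ j, Nat.card {i // part i = j} = n j
  local_code : ∀ i, ∃ S : Finset ι, i ∈ S ∧ (∀ i' ∈ S, part i' = part i) ∧
    S.card ≤ r (part i) + δ (part i) - 1 ∧ (δ (part i) : ℕ∞) ≤ minDist (puncture C S)

/-- The ordered `(r, δ)` condition. -/
def OrderedCondition {s : ℕ} (r δ : Fin s → ℕ) : Prop :=
  Monotone r ∧ Antitone δ

/-- The auxiliary parameter `k_j` attached to `(n_j, r_j, δ_j) = (n, r, δ)`. With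
`m = n / (r + δ - 1)` (a rational number) and `q = n mod (r + δ - 1)`, it is `⌊m⌋ r` if
`q ≤ δ - 2`, and `n - ⌈m⌉ (δ - 1)` otherwise. -/
def kParam (n r δ : ℕ) : ℤ :=
  let m : ℚ := (n : ℚ) / ((r : ℚ) + δ - 1)
  let q : ℕ := n % (r + δ - 1)
  if (q : ℤ) ≤ (δ : ℤ) - 2 then ⌊m⌋ * r else (n : ℤ) - ⌈m⌉ * ((δ : ℤ) - 1)

/-- `σ` is the index `s^* = min {j | k_1 + ⋯ + k_j ≥ k}`. -/
def IsSStar {s : ℕ} (n r δ : Fin s → ℕ) (k : ℕ) (σ : Fin s) : Prop :=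
  IsLeast {j : Fin s | (k : ℤ) ≤ ∑ i ∈ Finset.Iic j, kParam (n i) (r i) (δ i)} σ

/-- The right-hand side of the minimum distance bound, where `σ` plays the role of `s^*`. -/
def distBound {s : ℕ} (n r δ : Fin s → ℕ) (k : ℕ) (σ : Fin s) : ℤ :=
  (∑ j, (n j : ℤ)) - k + 1
    - ∑ j ∈ Finset.Iio σ, ((n j : ℤ) - kParam (n j) (r j) (δ j))
    - (⌈((k : ℚ) - ∑ j ∈ Finset.Iio σ, (kParam (n j) (r j) (δ j) : ℚ)) / (r σ : ℚ)⌉ - 1)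
      * ((δ σ : ℤ) - 1)

/-! ### The Gabidulin-based construction -/

/-- The linearized data polynomial `∑ a_i x^(q^(i-1))`, `i = 1, …, k` (here `i` starts at `0`). -/
noncomputable def linearizedPoly {L : Type*} [Field L] (q : ℕ) {k : ℕ} (a : Fin k → L) :
    Polynomial L :=
  ∑ i : Fin k, Polynomial.C (a i) * Polynomial.X ^ q ^ (i : ℕ)

/-- Gabidulin encoding: a message is sent to the values of its data polynomial at the points `x`. -/
noncomputable def gabidulinEncode {ι L : Type*} [Field L] (q k : ℕ) (x : ι → L) :
    (Fin k → L) →ₗ[L] (ι → L) where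
  toFun a p := (linearizedPoly q a).eval (x p)
  map_add' a b := by
    funext p
    simp [linearizedPoly, Polynomial.eval_finsetSum, add_mul, Finset.sum_add_distrib]
  map_smul' c a := by
    funext p
    simp [linearizedPoly, Polynomial.eval_finsetSum, Finset.mul_sum, mul_assoc]

/-- Indices of the Gabidulin codeword symbols: class `j`, one of the `m_j` local groups of the
class, and one of the `r_j` symbols of the group. -/
abbrev GabIndex {s : ℕ} (m r : Fin s → ℕ) : Type :=
  Σ j : Fin s, Fin (m j) × Fin (r j)

/-- Indices of the symbols of the final code: class `j`, one of the `m_j` local groups of the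
class, and one of the `r_j + δ_j - 1` symbols of the encoded group. -/
abbrev SymIndex {s : ℕ} (m r δ : Fin s → ℕ) : Type :=
  Σ j : Fin s, Fin (m j) × Fin (r j + δ j - 1)

/-- Local encoding: the local group `l` of class `j`, a vector of length `r_j` over `L`, is
multiplied by the generator matrix `G j l`, whose entries lie in the base field `K`. -/
def localEncode {K L : Type*} [Field K] [Field L] [Algebra K L] {s : ℕ} {m r δ : Fin s → ℕ}
    (G : ∀ j : Fin s, Fin (m j) → Matrix (Fin (r j)) (Fin (r j + δ j - 1)) K) :
    (GabIndex m r → L) →ₗ[L] (SymIndex m r δ → L) where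
  toFun u p :=
    Matrix.vecMul (fun i => u ⟨p.1, p.2.1, i⟩) ((G p.1 p.2.1).map (algebraMap K L)) p.2.2
  map_add' u v := by
    funext p
    simp [Matrix.vecMul, dotProduct, add_mul, Finset.sum_add_distrib]
  map_smul' c u := by
    funext p
    simp [Matrix.vecMul, dotProduct, Finset.mul_sum, mul_assoc]

/-- The Gabidulin-based code: `k` information symbols over `L` are precoded by a Gabidulin code
with evaluation points `x`, and each local group is then encoded with its own matrix `G j l`. -/
noncomputable def gabidulinLRC {K L : Type*} [Field K] [Fintype K] [Field L] [Algebra K L] {s : ℕ}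
    {m r δ : Fin s → ℕ} (k : ℕ) (x : GabIndex m r → L)
    (G : ∀ j : Fin s, Fin (m j) → Matrix (Fin (r j)) (Fin (r j + δ j - 1)) K) :
    Submodule L (SymIndex m r δ → L) :=
  LinearMap.range (localEncode G ∘ₗ gabidulinEncode (Fintype.card K) k x)

end UDLRC

namespace UDLRC

/-! Both bounds rest on one number. Let `v j` count the groups of class `j` filled when groups are
filled in order as long as the total rank stays at most `k - 1` (`greedyFill`); then `d = n - (k -
1) - ∑ v j * (δ j - 1)`, which `distBound_eq` identifies with the closed formula.

Upper bound, for any code with the locality: adding a local set to a set of forced zeros costs at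
most `r j` dimensions and yields `δ j - 1` zeros for free. Doing this `v j` times in each class
keeps the dimension positive; single coordinates then reduce it to one, and a surviving codeword has
weight at most `d` (`HasLocality.exists_hammingNorm_add_le`).

Lower bound, for the construction: each symbol is the value of a `K`-linear map at a `K`-combination
of the evaluation points, and the kernel of that map has dimension below `k`. By the MDS property,
up to `r j` symbols from each group have jointly independent points, so the zeros satisfy `∑ min |Z|
(r j) < k` (`sum_min_card_lt`). Only groups with at least `r j` zeros can have excess zeros, at most
`δ j - 1` each. The ordering of `r` and `δ` makes the greedy filling the largest possible total
excess (`sum_mul_le_of_greedy`). -/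

theorem minDist_le_hammingNorm {ι F : Type*} [Field F] [Fintype ι] {C : Submodule F (ι → F)} {c : ι → F} (hc : c ∈ C) (h0 : c ≠ 0)
    [DecidableEq F] : minDist C ≤ (hammingNorm c : ℕ∞) := by
  unfold minDist
  refine (iInf_le_of_le c <| iInf_le_of_le hc <| iInf_le_of_le h0 ?_)
  apply le_of_eq; congr

theorem le_minDist_iff {ι F : Type*} [Field F] [Fintype ι] {C : Submodule F (ι → F)} {d : ℕ∞} [DecidableEq F] :
    d ≤ minDist C ↔ ∀ c ∈ C, c ≠ 0 → d ≤ (hammingNorm c : ℕ∞) := by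
  refine ⟨fun h c hc h0 => h.trans (minDist_le_hammingNorm hc h0), fun h => ?_⟩
  unfold minDist
  refine le_iInf fun c => le_iInf fun hc => le_iInf fun h0 => (h c hc h0).trans (le_of_eq ?_)
  congr

/-! ### Upper bound for codes with locality, through subcodes with prescribed zeros. -/

section Bound

variable {ι F : Type*} [Field F]

/-- The subcode of the codewords that vanish on `T`. -/
def shortened (C : Submodule F (ι → F)) (T : Finset ι) : Submodule F (ι → F) where
  carrier := {c | c ∈ C ∧ ∀ i ∈ T, c i = 0}
  add_mem' ha hb := ⟨C.add_mem ha.1 hb.1, fun i hi => by simp [ha.2 i hi, hb.2 i hi]⟩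
  zero_mem' := ⟨C.zero_mem, fun _ _ => rfl⟩
  smul_mem' a _ hc := ⟨C.smul_mem a hc.1, fun i hi => by simp [hc.2 i hi]⟩

theorem mem_shortened {C : Submodule F (ι → F)} {T : Finset ι} {c : ι → F} :
    c ∈ shortened C T ↔ c ∈ C ∧ ∀ i ∈ T, c i = 0 := Iff.rfl

theorem shortened_empty (C : Submodule F (ι → F)) : shortened C ∅ = C := by
  ext c; simp [mem_shortened]

/-- A codeword vanishing on `S \ D` restricts to a word on `S` of weight at most `D.card < δ`, hence
to zero: the coordinates in `D` are free. -/
theorem shortened_union_sdiff [DecidableEq ι] {C : Submodule F (ι → F)} {S D : Finset ι} {δ : ℕ}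
    (hS : (δ : ℕ∞) ≤ minDist (puncture C S)) (hD : D.card < δ) (T : Finset ι) :
    shortened C (T ∪ S) = shortened C (T ∪ (S \ D)) := by
  classical
  ext c
  simp only [mem_shortened]
  refine and_congr_right fun hc => ⟨fun h i hi => h i ?_, fun h i hi => ?_⟩
  · rw [Finset.mem_union] at hi ⊢
    exact hi.imp_right fun h => (Finset.mem_sdiff.1 h).1
  · rcases Finset.mem_union.1 hi with hi | hi
    · exact h i (Finset.mem_union_left _ hi)
    · by_contra h0
      have hmem : (fun i : S => c i) ∈ puncture C S := ⟨c, hc, rfl⟩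
      have hne : (fun i : S => c i) ≠ 0 := fun h' => h0 (congrFun h' ⟨i, hi⟩)
      have hle := hS.trans (minDist_le_hammingNorm hmem hne)
      rw [Nat.cast_le] at hle
      have : hammingNorm (fun i : S => c i) ≤ D.card := by
        unfold hammingNorm
        refine Finset.card_le_card_of_injOn (fun i => (i : ι)) (fun j hj => ?_)
          Subtype.val_injective.injOn
        simp only [Finset.coe_filter, Finset.mem_univ, true_and, Set.mem_ofPred_eq] at hj
        by_contra hjD
        exact hj (h j (Finset.mem_union_right _ (Finset.mem_sdiff.2 ⟨j.2, hjD⟩)))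
      omega

variable [Fintype ι]

theorem finrank_shortened_union_add_card [DecidableEq ι] (C : Submodule F (ι → F))
    (T B : Finset ι) :
    Module.finrank F (shortened C T) ≤ Module.finrank F (shortened C (T ∪ B)) + B.card := by
  let φ : shortened C T →ₗ[F] (B → F) :=
    (LinearMap.funLeft F F (fun i : B => (i : ι))) ∘ₗ (shortened C T).subtype
  have h1 := φ.finrank_range_add_finrank_ker
  have h2 : Module.finrank F (LinearMap.range φ) ≤ B.card := by
    simpa using Submodule.finrank_le (LinearMap.range φ)
  have h3 : (LinearMap.ker φ).map (shortened C T).subtype ≤ shortened C (T ∪ B) := by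
    rintro _ ⟨c, hc, rfl⟩
    refine ⟨c.2.1, fun i hi => ?_⟩
    rcases Finset.mem_union.1 hi with hi | hi
    · exact c.2.2 i hi
    · exact congrFun (LinearMap.mem_ker.1 hc) ⟨i, hi⟩
  have h4 := Submodule.finrank_mono h3
  rw [Submodule.finrank_map_subtype_eq] at h4
  omega

/-- Adding a local set to `T` either leaves the subcode vanishing on `T` unchanged in dimension,
or costs at most `r` dimensions and gains at least `δ - 1` coordinates for free. -/
theorem finrank_shortened_union_local [DecidableEq ι] {C : Submodule F (ι → F)} {S : Finset ι}
    {r δ : ℕ} (hδ : 1 ≤ δ) (hS : (δ : ℕ∞) ≤ minDist (puncture C S)) (hc : S.card ≤ r + δ - 1)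
    (T : Finset ι) :
    Module.finrank F (shortened C (T ∪ S)) = Module.finrank F (shortened C T) ∨
    (Module.finrank F (shortened C T) ≤ Module.finrank F (shortened C (T ∪ S)) + r ∧
      T.card + Module.finrank F (shortened C T) + (δ - 1) ≤
        (T ∪ S).card + Module.finrank F (shortened C (T ∪ S))) := by
  -- If fewer than `δ` coordinates are new, all of them are free. Otherwise `δ - 1` new ones are
  -- free and the remaining ones, at most `r`, cost at most one dimension each.
  rcases lt_or_ge (S \ T).card δ with h | h
  · left
    rw [shortened_union_sdiff hS h]
    have : T ∪ S \ (S \ T) = T := by ext i; simp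
    rw [this]
  · right
    obtain ⟨D, hD, hDc⟩ := Finset.exists_subset_card_eq (show δ - 1 ≤ (S \ T).card by omega)
    have h1 := shortened_union_sdiff hS (D := D) (by omega) T
    have h2 : T ∪ (S \ D) = T ∪ ((S \ T) \ D) := by
      ext i; simp; tauto
    have h3 := finrank_shortened_union_add_card C T ((S \ T) \ D)
    rw [← h2, ← h1, Finset.card_sdiff_of_subset hD] at h3
    have h4 : (T ∪ S).card = T.card + (S \ T).card := by
      rw [← Finset.union_sdiff_self_eq_union, Finset.card_union_of_disjoint Finset.disjoint_sdiff]
    have h5 : (S \ T).card ≤ S.card := Finset.card_le_card Finset.sdiff_subset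
    omega

/-- The quantity to grow is the number of zeros plus the remaining dimension, by `δ - 1` per local
set. Choosing a largest admissible set at stage `v` absorbs all local sets that leave the dimension
unchanged, so the next one must bring a gain. -/
theorem exists_extension_in_class [DecidableEq ι] {C : Submodule F (ι → F)} {N : Finset ι}
    {m r δ : ℕ} (hδ : 1 ≤ δ) (hN : N.card = m * (r + δ - 1))
    (hloc : ∀ i ∈ N, ∃ S ⊆ N, i ∈ S ∧ S.card ≤ r + δ - 1 ∧ (δ : ℕ∞) ≤ minDist (puncture C S))
    {T : Finset ι} (hT : Disjoint T N) (v : ℕ) (hv : v ≤ m) :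
    ∃ T' ⊆ T ∪ N, T ⊆ T' ∧
      Module.finrank F (shortened C T) ≤ Module.finrank F (shortened C T') + v * r ∧
      T.card + Module.finrank F (shortened C T) + v * (δ - 1) ≤
        T'.card + Module.finrank F (shortened C T') := by
  induction v with
  | zero => exact ⟨T, Finset.subset_union_left, subset_rfl, by simp, by simp⟩
  | succ v ih =>
    let P : Finset (Finset ι) := (T ∪ N).powerset.filter fun T' => T ⊆ T' ∧
      Module.finrank F (shortened C T) ≤ Module.finrank F (shortened C T') + v * r ∧
      T.card + Module.finrank F (shortened C T) + v * (δ - 1) ≤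
        T'.card + Module.finrank F (shortened C T')
    have hP : P.Nonempty := by
      obtain ⟨T', h1, h2⟩ := ih (by omega)
      exact ⟨T', Finset.mem_filter.2 ⟨Finset.mem_powerset.2 h1, h2⟩⟩
    obtain ⟨T', hT', hmax⟩ := P.exists_max_image Finset.card hP
    obtain ⟨h1, h2, h3, h4⟩ := Finset.mem_filter.1 hT'
    rw [Finset.mem_powerset] at h1
    -- Once the class is exhausted, its size `m * r + m * (δ - 1)` pays for the lost dimension `v *
    -- r` and for the `v + 1` gains.
    by_cases hNT : N ⊆ T'
    · have : T' = T ∪ N := h1.antisymm (Finset.union_subset h2 hNT)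
      refine ⟨T', h1, h2, h3.trans (by gcongr; omega), ?_⟩
      have hc : T'.card = T.card + m * r + m * (δ - 1) := by
        rw [this, Finset.card_union_of_disjoint hT, hN, Nat.add_sub_assoc hδ]; ring
      have e1 : v * r ≤ m * r := by gcongr; omega
      have e2 : (v + 1) * (δ - 1) ≤ m * (δ - 1) := by gcongr
      omega
    · obtain ⟨i, hiN, hiT⟩ := Finset.not_subset.1 hNT
      obtain ⟨S, hSN, hiS, hSc, hSd⟩ := hloc i hiN
      have hsub : T' ∪ S ⊆ T ∪ N :=
        Finset.union_subset h1 (hSN.trans Finset.subset_union_right)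
      have hlt : T'.card < (T' ∪ S).card := Finset.card_lt_card
        ((Finset.ssubset_iff_of_subset Finset.subset_union_left).2
          ⟨i, Finset.mem_union_right _ hiS, hiT⟩)
      have hTT : T ⊆ T' ∪ S := h2.trans Finset.subset_union_left
      -- An unchanged dimension would make `T' ∪ S` a larger admissible set, against maximality.
      rcases finrank_shortened_union_local hδ hSd hSc T' with h | ⟨h, h'⟩
      · have := hmax (T' ∪ S) (Finset.mem_filter.2
          ⟨Finset.mem_powerset.2 hsub, hTT, by omega, by omega⟩)
        omega
      · refine ⟨T' ∪ S, hsub, hTT, ?_, ?_⟩ <;> rw [add_mul, one_mul] <;> omega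

/-- Classes are handled one at a time; a set built inside the earlier classes is disjoint from the
next one, so costs and gains add. -/
theorem exists_extension_in_classes {s : ℕ} {C : Submodule F (ι → F)} {part : ι → Fin s}
    {m r δ : Fin s → ℕ} (hδ : ∀ j, 1 ≤ δ j)
    (hC : HasLocality C part (fun j => m j * (r j + δ j - 1)) r δ)
    {v : Fin s → ℕ} (hv : ∀ j, v j ≤ m j) (J : Finset (Fin s)) :
    ∃ T : Finset ι, (∀ i ∈ T, part i ∈ J) ∧
      Module.finrank F C ≤ Module.finrank F (shortened C T) + ∑ j ∈ J, v j * r j ∧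
      Module.finrank F C + ∑ j ∈ J, v j * (δ j - 1) ≤
        T.card + Module.finrank F (shortened C T) := by
  classical
  induction J using Finset.induction_on with
  | empty => exact ⟨∅, by simp, by rw [shortened_empty]; simp, by rw [shortened_empty]; simp⟩
  | insert j J hj ih =>
    obtain ⟨T, h1, h2, h3⟩ := ih
    have hN : (Finset.univ.filter fun i => part i = j).card = m j * (r j + δ j - 1) := by
      rw [← hC.card_class j, Nat.card_eq_fintype_card, Fintype.card_subtype]
    have hdisj : Disjoint T (Finset.univ.filter fun i => part i = j) := by
      rw [Finset.disjoint_left]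
      intro i hi hi'
      exact hj ((Finset.mem_filter.1 hi').2 ▸ h1 i hi)
    obtain ⟨T', g1, -, g3, g4⟩ := exists_extension_in_class (C := C) (hδ j) hN
      (fun i hi => by
        obtain rfl := (Finset.mem_filter.1 hi).2
        obtain ⟨S, a, b, c, d⟩ := hC.local_code i
        exact ⟨S, fun i' hi' => by simpa using b i' hi', a, c, d⟩) hdisj (v j) (hv j)
    refine ⟨T', fun i hi => ?_, ?_, ?_⟩
    · rcases Finset.mem_union.1 (g1 hi) with h | h
      · exact Finset.mem_insert_of_mem (h1 i h)
      · simp [(Finset.mem_filter.1 h).2]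
    · rw [Finset.sum_insert hj]; omega
    · rw [Finset.sum_insert hj]; omega

/-- One more coordinate lowers the dimension by at most one, so zeros plus dimension never
decreases. A largest set with nonzero subcode has dimension one. -/
theorem exists_extension_finrank_eq_one (C : Submodule F (ι → F)) {T : Finset ι}
    (hT : 1 ≤ Module.finrank F (shortened C T)) :
    ∃ T' : Finset ι, Module.finrank F (shortened C T') = 1 ∧
      T.card + Module.finrank F (shortened C T) ≤ T'.card + 1 := by
  classical
  let P : Finset (Finset ι) := Finset.univ.filter fun T' =>
    1 ≤ Module.finrank F (shortened C T') ∧ T.card + Module.finrank F (shortened C T) ≤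
      T'.card + Module.finrank F (shortened C T')
  obtain ⟨T', hT', hmax⟩ := P.exists_max_image Finset.card
    ⟨T, by simp only [P, Finset.mem_filter, Finset.mem_univ]; exact ⟨trivial, hT, le_rfl⟩⟩
  obtain ⟨-, h1, h2⟩ := Finset.mem_filter.1 hT'
  suffices Module.finrank F (shortened C T') ≤ 1 from ⟨T', by omega, by omega⟩
  by_contra! h
  have hne : ∃ i, i ∉ T' := by
    by_contra! hall
    have : shortened C T' = ⊥ := by
      rw [eq_bot_iff]
      intro c hc
      exact funext fun i => hc.2 i (hall i)
    rw [this, finrank_bot] at h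
    omega
  obtain ⟨i, hi⟩ := hne
  have hcard : (T' ∪ {i}).card = T'.card + 1 := by
    rw [Finset.card_union_of_disjoint (by simpa using hi), Finset.card_singleton]
  have := finrank_shortened_union_add_card C T' {i}
  rw [Finset.card_singleton] at this
  have := hmax (T' ∪ {i}) (Finset.mem_filter.2 ⟨Finset.mem_univ _, by omega, by omega⟩)
  omega

/-- A code with locality has a codeword of small weight. -/
theorem HasLocality.exists_hammingNorm_add_le [DecidableEq F] {s : ℕ} {C : Submodule F (ι → F)}
    {part : ι → Fin s} {m r δ : Fin s → ℕ}
    (hC : HasLocality C part (fun j => m j * (r j + δ j - 1)) r δ) (hδ : ∀ j, 1 ≤ δ j)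
    {v : Fin s → ℕ} (hv : ∀ j, v j ≤ m j) (hvk : ∑ j, v j * r j < Module.finrank F C) :
    ∃ c ∈ C, c ≠ 0 ∧ hammingNorm c + (Module.finrank F C - 1) + ∑ j, v j * (δ j - 1) ≤
      Fintype.card ι := by
  classical
  obtain ⟨T, -, h1, h2⟩ := exists_extension_in_classes hδ hC hv Finset.univ
  obtain ⟨T', h3, h4⟩ := exists_extension_finrank_eq_one C (T := T) (by omega)
  obtain ⟨c, hc, h0⟩ := (shortened C T').exists_mem_ne_zero_of_ne_bot (by
    intro h; rw [h, finrank_bot] at h3; omega)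
  refine ⟨c, hc.1, h0, ?_⟩
  have : hammingNorm c ≤ T'ᶜ.card := by
    unfold hammingNorm
    refine Finset.card_le_card fun i hi => ?_
    rw [Finset.mem_compl]
    exact fun h => (Finset.mem_filter.1 hi).2 (hc.2 i h)
  rw [Finset.card_compl] at this
  have := Finset.card_le_univ T'
  omega

end Bound

/-! ### Matrices generating MDS codes, and extension of scalars. -/

section MDS

variable {K : Type*} [Field K] {k n : ℕ} {G : Matrix (Fin k) (Fin n) K}

theorem IsMDSGenerator.le_hammingNorm_vecMul [DecidableEq K] (hG : IsMDSGenerator G)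
    {a : Fin k → K} (ha : a ≠ 0) : n + 1 ≤ hammingNorm (Matrix.vecMul a G) + k := by
  have hmem : Matrix.vecMul a G ∈ rowCode G := by
    rw [Matrix.vecMul_eq_sum]
    exact Submodule.sum_mem _ fun i _ =>
      Submodule.smul_mem _ _ (Submodule.subset_span ⟨i, rfl⟩)
  have hne : Matrix.vecMul a G ≠ 0 := fun h =>
    ha (Matrix.vecMul_injective_iff.2 hG.linearIndependent_rows (by simpa using h))
  have h := minDist_le_hammingNorm hmem hne
  have h2 := hG.minDist_add
  have : ((n + 1 : ℕ) : ℕ∞) ≤ ((hammingNorm (Matrix.vecMul a G) + k : ℕ) : ℕ∞) := by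
    push_cast
    rw [← h2]
    gcongr
  exact_mod_cast this

/-- At most `k` columns of a generator matrix of an MDS code of dimension `k` are linearly
independent. -/
theorem IsMDSGenerator.eq_zero_of_mulVec_eq_zero (hG : IsMDSGenerator G) (hkn : k ≤ n)
    {B : Finset (Fin n)} (hB : B.card ≤ k) {c : Fin n → K} (hc : ∀ p ∉ B, c p = 0)
    (h0 : Matrix.mulVec G c = 0) : c = 0 := by
  classical
  obtain ⟨B', hBB', hB'⟩ := Finset.exists_superset_card_eq hB (by simpa using hkn)
  let φ : (Fin k → K) →ₗ[K] (B' → K) :=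
    (LinearMap.funLeft K K (fun i : B' => (i : Fin n))) ∘ₗ G.vecMulLinear
  -- A nonzero codeword vanishing on the `k` positions of `B'` would have weight at most `n - k`.
  have hφ : Function.Injective φ := by
    rw [← LinearMap.ker_eq_bot, eq_bot_iff]
    intro a ha
    by_contra hne
    have h1 := hG.le_hammingNorm_vecMul (a := a) (by simpa using hne)
    have h2 : hammingNorm (Matrix.vecMul a G) ≤ B'ᶜ.card := by
      unfold hammingNorm
      refine Finset.card_le_card fun i hi => ?_
      rw [Finset.mem_compl]
      exact fun h => (Finset.mem_filter.1 hi).2 (congrFun (LinearMap.mem_ker.1 ha) ⟨i, h⟩)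
    rw [Finset.card_compl, Fintype.card_fin] at h2
    omega
  have hsurj : Function.Surjective φ :=
    (LinearMap.injective_iff_surjective_of_finrank_eq_finrank (by simp [hB'])).1 hφ
  funext b
  by_cases hb : b ∈ B'
  · obtain ⟨a, ha⟩ := hsurj (Pi.single ⟨b, hb⟩ 1)
    have h1 : dotProduct (Matrix.vecMul a G) c = 0 := by
      rw [← Matrix.dotProduct_mulVec, h0, dotProduct_zero]
    rw [dotProduct, Finset.sum_eq_single b] at h1
    · have h2 : Matrix.vecMul a G b = 1 := by
        simpa [φ, LinearMap.funLeft] using congrFun ha ⟨b, hb⟩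
      simpa [h2] using h1
    · intro p _ hp
      by_cases hpB : p ∈ B'
      · have h2 : Matrix.vecMul a G p = 0 := by
          simpa [φ, LinearMap.funLeft, Pi.single_apply, hp] using congrFun ha ⟨p, hpB⟩
        rw [h2, zero_mul]
      · rw [hc p fun h => hpB (hBB' h), mul_zero]
    · simp
  · exact hc b fun h => hb (hBB' h)

/-- The minimum distance of an MDS code does not decrease under extension of scalars. -/
theorem IsMDSGenerator.le_hammingNorm_vecMul_map {L : Type*} [Field L] [Algebra K L]
    [DecidableEq L] (hG : IsMDSGenerator G) {u : Fin k → L}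
    (hu : Matrix.vecMul u (G.map (algebraMap K L)) ≠ 0) :
    n + 1 ≤ hammingNorm (Matrix.vecMul u (G.map (algebraMap K L))) + k := by
  classical
  obtain ⟨p, hp⟩ := Function.ne_iff.1 hu
  -- A `K`-linear functional applied to each entry sends the word over `L` to a codeword over `K`
  -- without enlarging its support; choosing it nonzero at `p` keeps the image nonzero.
  have hφ : ∃ φ : Module.Dual K L, φ (Matrix.vecMul u (G.map (algebraMap K L)) p) ≠ 0 := by
    by_contra! h
    exact hp ((Module.forall_dual_apply_eq_zero_iff K _).1 h)
  obtain ⟨φ, hφ⟩ := hφ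
  have key : ∀ p, φ (Matrix.vecMul u (G.map (algebraMap K L)) p) =
      Matrix.vecMul (fun i => φ (u i)) G p := by
    intro p
    simp only [Matrix.vecMul, dotProduct, Matrix.map_apply, map_sum]
    refine Finset.sum_congr rfl fun i _ => ?_
    rw [mul_comm, ← Algebra.smul_def, map_smul, smul_eq_mul, mul_comm]
  have hne : (fun i => φ (u i)) ≠ 0 := by
    intro h
    rw [key, h] at hφ
    simp at hφ
  refine (hG.le_hammingNorm_vecMul hne).trans (Nat.add_le_add_right ?_ _)
  unfold hammingNorm
  refine Finset.card_le_card fun q hq => ?_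
  simp only [Finset.mem_filter, Finset.mem_univ, true_and] at hq ⊢
  intro h
  rw [← key, h, map_zero] at hq
  exact hq rfl

end MDS

/-! ### Kernels of linearized polynomials. -/

section Gabidulin

open Polynomial

variable {K L : Type*} [Field K] [Fintype K] [Field L] [Algebra K L]

theorem coeff_linearizedPoly {q k : ℕ} (hq : 1 < q) (a : Fin k → L) (i : Fin k) :
    (linearizedPoly q a).coeff (q ^ (i : ℕ)) = a i := by
  simp only [linearizedPoly, finsetSum_coeff, coeff_C_mul, coeff_X_pow]
  rw [Finset.sum_eq_single i]
  · simp
  · intro j _ hj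
    rw [if_neg, mul_zero]
    exact fun h => hj (Fin.ext (Nat.pow_right_injective hq h.symm))
  · simp

theorem natDegree_linearizedPoly_le {q k : ℕ} (hq : 1 < q) (a : Fin k → L) :
    (linearizedPoly q a).natDegree ≤ q ^ (k - 1) := by
  refine natDegree_sum_le_of_forall_le _ _ fun i _ => (natDegree_C_mul_X_pow_le _ _).trans ?_
  exact Nat.pow_le_pow_right hq.le (by omega)

variable (K) in
/-- The linearized polynomial as a linear map over the base field. -/
noncomputable def linearizedMap {k : ℕ} (a : Fin k → L) : L →ₗ[K] L :=
  ∑ i : Fin k, a i • (FiniteField.frobeniusAlgHom K L ^ (i : ℕ)).toLinearMap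

theorem linearizedMap_apply {k : ℕ} (a : Fin k → L) (y : L) :
    linearizedMap K a y = (linearizedPoly (Fintype.card K) a).eval y := by
  simp [linearizedMap, linearizedPoly, eval_finsetSum, AlgHom.coe_pow,
    FiniteField.coe_frobeniusAlgHom, pow_iterate]

/-- Kernel elements are roots of a nonzero polynomial of degree at most `q ^ (k - 1)`, while a
kernel of dimension `e` has `q ^ e` elements. -/
theorem finrank_ker_linearizedMap_lt [Fintype L] {k : ℕ} {a : Fin k → L} (ha : a ≠ 0) :
    Module.finrank K (LinearMap.ker (linearizedMap K a)) < k := by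
  classical
  have hq : 1 < Fintype.card K := Fintype.one_lt_card
  obtain ⟨i, hi⟩ := Function.ne_iff.1 ha
  have hp : linearizedPoly (Fintype.card K) a ≠ 0 := fun h => hi (by
    rw [← coeff_linearizedPoly hq a i, h]; simp)
  have h1 : Fintype.card (LinearMap.ker (linearizedMap K a)) ≤ Fintype.card K ^ (k - 1) := by
    refine le_trans ?_ ((card_roots' _).trans (natDegree_linearizedPoly_le hq a))
    refine le_trans ?_ (Multiset.toFinset_card_le _)
    refine Finset.card_le_card_of_injOn (s := Finset.univ) Subtype.val (fun y _ => ?_)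
      Subtype.val_injective.injOn
    rw [Finset.mem_coe, Multiset.mem_toFinset, mem_roots hp, IsRoot.def, ← linearizedMap_apply]
    exact y.2
  rw [Module.card_eq_pow_finrank (K := K)] at h1
  have := (Nat.pow_le_pow_iff_right hq).1 h1
  have := i.2
  omega

end Gabidulin

/-! ### Evaluation points of the final symbols and their independence. -/

section Construction

variable {K L : Type*} [Field K] [Field L] [Algebra K L] {s : ℕ} {m r δ : Fin s → ℕ}

/-- The point of `L` at which the symbol `p` evaluates the data polynomial. -/
def localPoint (x : GabIndex m r → L)
    (G : ∀ j : Fin s, Fin (m j) → Matrix (Fin (r j)) (Fin (r j + δ j - 1)) K)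
    (p : SymIndex m r δ) : L :=
  ∑ i, G p.1 p.2.1 i p.2.2 • x ⟨p.1, p.2.1, i⟩

/-- The local matrices have entries in `K` and evaluation is `K`-linear, so local encoding may be
moved onto the evaluation points. -/
theorem localEncode_gabidulinEncode [Fintype K] {k : ℕ} (x : GabIndex m r → L)
    (G : ∀ j : Fin s, Fin (m j) → Matrix (Fin (r j)) (Fin (r j + δ j - 1)) K)
    (a : Fin k → L) (p : SymIndex m r δ) :
    localEncode G (gabidulinEncode (Fintype.card K) k x a) p =
      linearizedMap K a (localPoint x G p) := by
  rw [localPoint, map_sum]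
  simp only [map_smul, linearizedMap_apply]
  change ∑ i, (linearizedPoly (Fintype.card K) a).eval (x ⟨p.1, p.2.1, i⟩) *
    algebraMap K L (G p.1 p.2.1 i p.2.2) = _
  simp only [Algebra.smul_def, mul_comm]

theorem sum_smul_localPoint (x : GabIndex m r → L)
    (G : ∀ j : Fin s, Fin (m j) → Matrix (Fin (r j)) (Fin (r j + δ j - 1)) K)
    (g : SymIndex m r δ → K) :
    ∑ p, g p • localPoint x G p =
      ∑ t : GabIndex m r, Matrix.mulVec (G t.1 t.2.1) (fun c => g ⟨t.1, t.2.1, c⟩) t.2.2 • x t := by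
  simp only [Fintype.sum_sigma, Fintype.sum_prod_type, localPoint, Finset.smul_sum, smul_smul,
    Matrix.mulVec, dotProduct, Finset.sum_smul]
  refine Finset.sum_congr rfl fun j _ => Finset.sum_congr rfl fun l _ => ?_
  change ∑ c : Fin (r j + δ j - 1), ∑ i : Fin (r j), (g ⟨j, l, c⟩ * G j l i c) • x ⟨j, l, i⟩ = _
  rw [Finset.sum_comm]
  simp only [mul_comm]

/-- Independence of `x` splits a relation into one equation `G j l *ᵥ c = 0` per group, with `c`
supported on at most `r j` positions; the MDS property then gives `c = 0`. -/
theorem linearIndepOn_localPoint (hδ : ∀ j, 1 ≤ δ j) {x : GabIndex m r → L}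
    (hx : LinearIndependent K x)
    {G : ∀ j : Fin s, Fin (m j) → Matrix (Fin (r j)) (Fin (r j + δ j - 1)) K}
    (hG : ∀ j l, IsMDSGenerator (G j l))
    {B : ∀ j : Fin s, Fin (m j) → Finset (Fin (r j + δ j - 1))}
    (hB : ∀ j l, (B j l).card ≤ r j) :
    LinearIndepOn K (localPoint x G) {p | p.2.2 ∈ B p.1 p.2.1} := by
  classical
  have hset : {p : SymIndex m r δ | p.2.2 ∈ B p.1 p.2.1} =
    (Finset.univ.filter fun p : SymIndex m r δ => p.2.2 ∈ B p.1 p.2.1 : Finset _) := by ext; simp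
  rw [hset, linearIndepOn_finset_iff]
  intro g hg
  let g' : SymIndex m r δ → K := fun p => if p.2.2 ∈ B p.1 p.2.1 then g p else 0
  have h1 : ∑ p, g' p • localPoint x G p = 0 := by
    rw [← hg, Finset.sum_filter]
    refine Finset.sum_congr rfl fun p _ => ?_
    simp only [g']
    split_ifs <;> simp
  rw [sum_smul_localPoint] at h1
  have h2 := Fintype.linearIndependent_iff.1 hx _ h1
  intro p hp
  have h3 := (hG p.1 p.2.1).eq_zero_of_mulVec_eq_zero (by have := hδ p.1; omega) (hB p.1 p.2.1)
    (c := fun c => g' ⟨p.1, p.2.1, c⟩) (fun c hc => if_neg hc)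
    (funext fun i => h2 ⟨p.1, p.2.1, i⟩)
  have h4 : g' p = 0 := congrFun h3 p.2.2
  rwa [show g' p = g p from if_pos (by simpa using hp)] at h4

theorem card_filter_symIndex (B : ∀ j : Fin s, Fin (m j) → Finset (Fin (r j + δ j - 1))) :
    (Finset.univ.filter fun p : SymIndex m r δ => p.2.2 ∈ B p.1 p.2.1).card =
      ∑ j, ∑ l, (B j l).card := by
  rw [Finset.card_filter]
  simp only [Fintype.sum_sigma, Fintype.sum_prod_type]
  refine Finset.sum_congr rfl fun j _ => Finset.sum_congr rfl fun l _ => ?_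
  rw [← Finset.card_filter, Finset.filter_univ_mem]

/-- The zero set of a nonzero data polynomial has rank less than `k`. -/
theorem sum_min_card_lt [Fintype K] [Fintype L] {k : ℕ} (hδ : ∀ j, 1 ≤ δ j)
    {x : GabIndex m r → L} (hx : LinearIndependent K x)
    {G : ∀ j : Fin s, Fin (m j) → Matrix (Fin (r j)) (Fin (r j + δ j - 1)) K}
    (hG : ∀ j l, IsMDSGenerator (G j l)) {a : Fin k → L} (ha : a ≠ 0)
    {Z : ∀ j : Fin s, Fin (m j) → Finset (Fin (r j + δ j - 1))}
    (hZ : ∀ j l, ∀ c ∈ Z j l,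
      localEncode G (gabidulinEncode (Fintype.card K) k x a) ⟨j, l, c⟩ = 0) :
    ∑ j, ∑ l, min (Z j l).card (r j) < k := by
  classical
  -- Capping each group's zeros at `r j` makes their points independent; all of them lie in the
  -- kernel.
  choose B hBZ hB using fun j l =>
    Finset.exists_subset_card_eq (min_le_left (Z j l).card (r j))
  have h1 := linearIndepOn_localPoint hδ hx hG (B := B) fun j l => by simp [hB]
  simp only [← hB]
  rw [← card_filter_symIndex]
  refine lt_of_le_of_lt ?_ (finrank_ker_linearizedMap_lt (K := K) ha)
  let w : {p : SymIndex m r δ | p.2.2 ∈ B p.1 p.2.1} → LinearMap.ker (linearizedMap K a) :=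
    fun p => ⟨localPoint x G p, by
      rw [LinearMap.mem_ker, ← localEncode_gabidulinEncode]
      exact hZ _ _ _ (hBZ _ _ p.2)⟩
  have hw : LinearIndependent K w :=
    LinearIndependent.of_comp (LinearMap.ker (linearizedMap K a)).subtype h1
  have := hw.fintype_card_le_finrank
  rwa [← Fintype.card_subtype]

end Construction

/-! ### The exchange argument and the arithmetic of the distance formula. -/

section Greedy

variable {s : ℕ}

/-- Filling the groups in order is the best way to spend a rank budget `b` when the ranks increase
and the gains decrease. -/
theorem sum_mul_le_of_greedy {m r D v w : Fin s → ℕ} {b : ℕ} {σ : Fin s} (hr : Monotone r)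
    (hD : Antitone D) (hlt : ∀ j < σ, v j = m j) (hgt : ∀ j, σ < j → v j = 0)
    (hb : b < ∑ j, v j * r j + r σ) (hw : ∀ j, w j ≤ m j) (hwb : ∑ j, w j * r j ≤ b) :
    ∑ j, w j * D j ≤ ∑ j, v j * D j := by
  -- Before `σ` the choice `w` has no more groups than `v` and these are no dearer than `r σ`; after
  -- `σ` it has no fewer and these are no cheaper. So pricing every group at `r σ` underestimates
  -- the change of cost; `h2` is the same argument for gains.
  have h1 : (r σ : ℤ) * ∑ j, ((w j : ℤ) - v j) ≤ ∑ j, ((w j : ℤ) - v j) * r j := by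
    rw [Finset.mul_sum]
    refine Finset.sum_le_sum fun j _ => ?_
    rcases lt_trichotomy j σ with h | h | h
    · have e1 : (r j : ℤ) ≤ r σ := by exact_mod_cast hr h.le
      have e2 : (w j : ℤ) ≤ v j := by rw [hlt j h]; exact_mod_cast hw j
      nlinarith
    · rw [h, mul_comm]
    · have e1 : (r σ : ℤ) ≤ r j := by exact_mod_cast hr h.le
      have e2 : (v j : ℤ) ≤ w j := by rw [hgt j h]; simp
      nlinarith
  have h2 : (D σ : ℤ) * ∑ j, ((v j : ℤ) - w j) ≤ ∑ j, ((v j : ℤ) - w j) * D j := by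
    rw [Finset.mul_sum]
    refine Finset.sum_le_sum fun j _ => ?_
    rcases lt_trichotomy j σ with h | h | h
    · have e1 : (D σ : ℤ) ≤ D j := by exact_mod_cast hD h.le
      have e2 : (w j : ℤ) ≤ v j := by rw [hlt j h]; exact_mod_cast hw j
      nlinarith
    · rw [h, mul_comm]
    · have e1 : (D j : ℤ) ≤ D σ := by exact_mod_cast hD h.le
      have e2 : (v j : ℤ) ≤ w j := by rw [hgt j h]; simp
      nlinarith
  have h3 : ∑ j, ((w j : ℤ) - v j) * r j < r σ := by
    simp only [sub_mul, Finset.sum_sub_distrib]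
    have : ((∑ j, w j * r j : ℕ) : ℤ) < ((∑ j, v j * r j + r σ : ℕ) : ℤ) := by
      exact_mod_cast hwb.trans_lt hb
    push_cast at this
    linarith
  -- By `h1` and `h3`, `r σ` times this integer is below `r σ`, so the integer is at most zero.
  have h4 : ∑ j, ((w j : ℤ) - v j) ≤ 0 := by
    by_contra! h
    have : (0 : ℤ) ≤ r σ := by positivity
    nlinarith
  have h5 : ∑ j, ((v j : ℤ) - w j) = - ∑ j, ((w j : ℤ) - v j) := by
    rw [← Finset.sum_neg_distrib]; simp
  have h6 : (0 : ℤ) ≤ ∑ j, ((v j : ℤ) - w j) * D j :=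
    le_trans (mul_nonneg (by positivity) (by omega)) h2
  simp only [sub_mul, Finset.sum_sub_distrib] at h6
  zify
  linarith

/-- The number of groups of each class that are filled completely by the greedy choice. -/
def greedyFill (m r : Fin s → ℕ) (k : ℕ) (σ : Fin s) (j : Fin s) : ℕ :=
  -- The budget is `k - 1` so that a nonzero codeword survives; the quotient is the ceiling in the
  -- distance formula minus one.
  if j < σ then m j else if j = σ then (k - 1 - ∑ i ∈ Finset.Iio σ, m i * r i) / r σ else 0

theorem sum_greedyFill_mul (m r : Fin s → ℕ) (k : ℕ) (σ : Fin s) (D : Fin s → ℕ) :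
    ∑ j, greedyFill m r k σ j * D j = ∑ j ∈ Finset.Iio σ, m j * D j +
      (k - 1 - ∑ i ∈ Finset.Iio σ, m i * r i) / r σ * D σ := by
  have h : ∀ j, greedyFill m r k σ j * D j = (if j < σ then m j * D j else 0) +
      if j = σ then (k - 1 - ∑ i ∈ Finset.Iio σ, m i * r i) / r σ * D j else 0 := by
    intro j
    unfold greedyFill
    rcases lt_trichotomy j σ with h | h | h
    · simp [h, h.ne]
    · simp [h]
    · simp [h.not_gt, h.ne']
  simp only [h, Finset.sum_add_distrib, Finset.sum_ite_eq', Finset.mem_univ, if_true]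
  rw [← Finset.sum_filter]
  congr 2
  ext; simp

/-- Minimality of `σ` is applied to its predecessor; at the first index the sum is empty and `1 ≤ k`
decides. -/
theorem sum_Iio_lt {m r : Fin s → ℕ} {k : ℕ} {σ : Fin s} (hk : 1 ≤ k)
    (hσ : IsLeast {j | k ≤ ∑ i ∈ Finset.Iic j, m i * r i} σ) :
    ∑ i ∈ Finset.Iio σ, m i * r i < k := by
  by_contra! h
  rcases Nat.eq_zero_or_pos (σ : ℕ) with h0 | h0
  · have : Finset.Iio σ = ∅ := by
      ext j; simp [Fin.le_def, h0]
    simp [this] at h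
    omega
  · have hlt : (σ : ℕ) - 1 < s := by omega
    have : Finset.Iic (⟨(σ : ℕ) - 1, hlt⟩ : Fin s) = Finset.Iio σ := by
      ext j; rw [Finset.mem_Iic, Finset.mem_Iio, Fin.le_def, Fin.lt_def]; simp only; omega
    have h1 := hσ.2 (show (⟨(σ : ℕ) - 1, hlt⟩ : Fin s) ∈ _ by
      rw [Set.mem_ofPred_eq, this]; exact h)
    rw [Fin.le_def] at h1
    simp only at h1
    omega

theorem greedyFill_le {m r : Fin s → ℕ} {k : ℕ} {σ : Fin s}
    (hσ : IsLeast {j | k ≤ ∑ i ∈ Finset.Iic j, m i * r i} σ) (j : Fin s) :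
    greedyFill m r k σ j ≤ m j := by
  unfold greedyFill
  split_ifs with h1 h2
  · exact le_rfl
  · subst h2
    have h := hσ.1
    rw [Set.mem_ofPred_eq, ← Finset.Iio_insert, Finset.sum_insert (by simp)] at h
    exact Nat.div_le_of_le_mul (by rw [mul_comm]; omega)
  · exact Nat.zero_le _

theorem kParam_mul {m r δ : ℕ} (hr : 1 ≤ r) (hδ : 1 ≤ δ) :
    kParam (m * (r + δ - 1)) r δ = m * r := by
  have h0 : ((r + δ - 1 : ℕ) : ℚ) = (r : ℚ) + δ - 1 := by
    rw [Nat.cast_sub (by omega)]; push_cast; ring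
  have h1 : (r : ℚ) + δ - 1 ≠ 0 := by
    rw [← h0]; exact_mod_cast (by omega : r + δ - 1 ≠ 0)
  have h2 : ((m * (r + δ - 1) : ℕ) : ℚ) / ((r : ℚ) + δ - 1) = (m : ℤ) := by
    rw [Nat.cast_mul, h0]; field_simp; simp
  unfold kParam
  simp only [h2, Int.floor_intCast, Int.ceil_intCast]
  -- The class length is a multiple of `r + δ - 1`, so floor and ceiling coincide and both branches
  -- give `m * r`.
  split_ifs
  · rfl
  · push_cast [Nat.cast_sub (show 1 ≤ r + δ by omega)]; ring

/-- This links the ceiling in `distBound` to the quotient in `greedyFill`; the shift to `a - 1`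
handles exact multiples of `r`. -/
theorem ceil_div_sub_one {a r : ℕ} (hr : 1 ≤ r) (ha : 1 ≤ a) :
    ⌈(a : ℚ) / r⌉ - 1 = ((a - 1) / r : ℕ) := by
  have hr' : (0 : ℚ) < r := by exact_mod_cast hr
  have h1 := Nat.div_mul_le_self (a - 1) r
  have h2 := Nat.lt_div_mul_add (a := a - 1) (b := r) hr
  generalize (a - 1) / r = t at h1 h2 ⊢
  have h3 : ((t * r : ℕ) : ℚ) < a := by exact_mod_cast (by omega)
  have h4 : (a : ℚ) ≤ ((t * r + r : ℕ) : ℚ) := by exact_mod_cast (by omega)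
  push_cast at h3 h4
  rw [sub_eq_iff_eq_add, Int.ceil_eq_iff, lt_div_iff₀ hr', div_le_iff₀ hr']
  constructor <;> push_cast <;> linarith

theorem distBound_eq {m r δ : Fin s → ℕ} {k : ℕ} {σ : Fin s} (hr : ∀ j, 1 ≤ r j)
    (hδ : ∀ j, 1 ≤ δ j) (hk : 1 ≤ k)
    (hσ : IsLeast {j | k ≤ ∑ i ∈ Finset.Iic j, m i * r i} σ) :
    distBound (fun j => m j * (r j + δ j - 1)) r δ k σ =
      ((∑ j, m j * (r j + δ j - 1) : ℕ) : ℤ) - (k - 1 : ℕ) -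
        (∑ j, greedyFill m r k σ j * (δ j - 1) : ℕ) := by
  have hP := sum_Iio_lt hk hσ
  have h1 : ∀ j, ((m j * (r j + δ j - 1) : ℕ) : ℤ) -
      kParam (m j * (r j + δ j - 1)) (r j) (δ j) = (m j * (δ j - 1) : ℕ) := by
    intro j
    rw [kParam_mul (hr j) (hδ j), Nat.add_sub_assoc (hδ j)]
    push_cast; ring
  have h2 : ((k : ℚ) - ∑ j ∈ Finset.Iio σ, (kParam (m j * (r j + δ j - 1)) (r j) (δ j) : ℚ)) =
      ((k - ∑ i ∈ Finset.Iio σ, m i * r i : ℕ) : ℚ) := by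
    rw [Nat.cast_sub hP.le]
    simp [kParam_mul (hr _) (hδ _)]
  unfold distBound
  simp only [h1, h2]
  rw [ceil_div_sub_one (hr σ) (by omega), sum_greedyFill_mul, Nat.sub_right_comm]
  push_cast [Nat.cast_sub hk, Nat.cast_sub (hδ σ)]
  ring

theorem isSStar_iff {m r δ : Fin s → ℕ} {k : ℕ} {σ : Fin s} (hr : ∀ j, 1 ≤ r j)
    (hδ : ∀ j, 1 ≤ δ j) : IsSStar (fun j => m j * (r j + δ j - 1)) r δ k σ ↔
      IsLeast {j | k ≤ ∑ i ∈ Finset.Iic j, m i * r i} σ := by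
  unfold IsSStar
  simp only [kParam_mul (hr _) (hδ _)]
  norm_cast

theorem exists_isLeast {m r : Fin s → ℕ} {k : ℕ} (hk : 1 ≤ k) (h : k ≤ ∑ j, m j * r j) :
    ∃ σ, IsLeast {j | k ≤ ∑ i ∈ Finset.Iic j, m i * r i} σ := by
  have hs : 0 < s := by
    rcases Nat.eq_zero_or_pos s with rfl | h'
    · simp at h; omega
    · exact h'
  obtain ⟨σ, hσ, hmin⟩ := Set.exists_min_image {j : Fin s | k ≤ ∑ i ∈ Finset.Iic j, m i * r i} id
    (Set.toFinite _) ⟨⟨s - 1, by omega⟩, by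
      have : Finset.Iic (⟨s - 1, by omega⟩ : Fin s) = Finset.univ := by
        ext j; simp [Fin.le_def]; omega
      rw [Set.mem_ofPred_eq, this]; exact h⟩
  exact ⟨σ, hσ, hmin⟩

end Greedy

/-! ### Dimension, locality and weights of the constructed code. -/

section Construction

variable {K L : Type*} [Field K] [Fintype K] [Field L] [Algebra K L] {s : ℕ}
  {m r δ : Fin s → ℕ} {k : ℕ} {x : GabIndex m r → L}
  {G : ∀ j : Fin s, Fin (m j) → Matrix (Fin (r j)) (Fin (r j + δ j - 1)) K}

/-- If a nonzero message were encoded as zero, every group would be full of zeros, and the capped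
count would be `∑ j, m j * r j ≥ k`. -/
theorem encode_injective [Fintype L] (hδ : ∀ j, 1 ≤ δ j) (hk : k ≤ ∑ j, m j * r j)
    (hx : LinearIndependent K x) (hG : ∀ j l, IsMDSGenerator (G j l)) :
    Function.Injective (localEncode G ∘ₗ gabidulinEncode (Fintype.card K) k x) := by
  rw [← LinearMap.ker_eq_bot, eq_bot_iff]
  intro a ha
  by_contra hne
  have := sum_min_card_lt hδ hx hG (a := a) (by simpa using hne) (Z := fun _ _ => Finset.univ)
    fun j l c _ => congrFun (LinearMap.mem_ker.1 ha) ⟨j, l, c⟩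
  have h : ∀ j, min (r j + δ j - 1) (r j) = r j := fun j => by have := hδ j; omega
  simp [h] at this
  omega

theorem finrank_gabidulinLRC [Fintype L] (hδ : ∀ j, 1 ≤ δ j) (hk : k ≤ ∑ j, m j * r j)
    (hx : LinearIndependent K x) (hG : ∀ j l, IsMDSGenerator (G j l)) :
    Module.finrank L (gabidulinLRC k x G) = k := by
  unfold gabidulinLRC
  rw [LinearMap.finrank_range_of_inj (encode_injective hδ hk hx hG)]
  simp

theorem hasLocality_gabidulinLRC (hδ : ∀ j, 1 ≤ δ j) (hG : ∀ j l, IsMDSGenerator (G j l)) :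
    HasLocality (gabidulinLRC k x G) (fun p => p.1) (fun j => m j * (r j + δ j - 1)) r δ where
  card_class j := by
    rw [Nat.card_congr (Equiv.sigmaSubtype j)]
    simp
  local_code := by
    classical
    rintro ⟨j, l, c⟩
    -- The local set is the whole encoded group.
    refine ⟨Finset.univ.image fun c' => ⟨j, l, c'⟩, by simp, by simp, ?_, ?_⟩
    · exact Finset.card_image_le.trans (by simp)
    · rw [le_minDist_iff]
      rintro _ ⟨_, ⟨a, rfl⟩, rfl⟩ hne
      set u := gabidulinEncode (Fintype.card K) k x a with hu
      set w := Matrix.vecMul (fun i => u ⟨j, l, i⟩) ((G j l).map (algebraMap K L)) with hw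
      have hw0 : w ≠ 0 := by
        intro h0
        refine hne (funext ?_)
        rintro ⟨p, hp⟩
        obtain ⟨c', -, rfl⟩ := Finset.mem_image.1 hp
        exact congrFun h0 c'
      have h1 := (hG j l).le_hammingNorm_vecMul_map hw0
      rw [← hw] at h1
      rw [Nat.cast_le]
      refine le_trans (by have := hδ j; simp only; omega) (b := hammingNorm w) ?_
      unfold hammingNorm
      refine Finset.card_le_card_of_injOn
        (fun c' => ⟨⟨j, l, c'⟩, Finset.mem_image_of_mem _ (Finset.mem_univ c')⟩) ?_ ?_
      · intro c' hc'
        simp only [Finset.coe_filter, Finset.mem_univ, true_and, Set.mem_ofPred_eq] at hc' ⊢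
        exact hc'
      · intro c' _ c'' _ h
        simpa using h

/-- Lower bound for the weights of the nonzero codewords. -/
theorem card_le_hammingNorm_add [Fintype L] [DecidableEq L] (hr : ∀ j, 1 ≤ r j)
    (hδ : ∀ j, 1 ≤ δ j) (hk : 1 ≤ k)
    (hord : OrderedCondition r δ) (hx : LinearIndependent K x)
    (hG : ∀ j l, IsMDSGenerator (G j l)) {σ : Fin s}
    {c : SymIndex m r δ → L} (hc : c ∈ gabidulinLRC k x G) (h0 : c ≠ 0) :
    Fintype.card (SymIndex m r δ) ≤
      hammingNorm c + (k - 1) + ∑ j, greedyFill m r k σ j * (δ j - 1) := by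
  obtain ⟨a, rfl⟩ := hc
  have ha : a ≠ 0 := by rintro rfl; simp at h0
  set c := (localEncode G ∘ₗ gabidulinEncode (Fintype.card K) k x) a with hc
  let Z : ∀ j : Fin s, Fin (m j) → Finset (Fin (r j + δ j - 1)) := fun j l =>
    Finset.univ.filter fun e => c ⟨j, l, e⟩ = 0
  have h1 : ∑ j, ∑ l, min (Z j l).card (r j) < k :=
    sum_min_card_lt hδ hx hG ha fun j l e he => (Finset.mem_filter.1 he).2
  have h2 : Fintype.card (SymIndex m r δ) = hammingNorm c + ∑ j, ∑ l, (Z j l).card := by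
    rw [← card_filter_symIndex, hammingNorm, add_comm, ← Finset.card_univ,
      ← Finset.card_filter_add_card_filter_not (fun p => c p = 0)]
    simp only [Z, Finset.mem_filter, Finset.mem_univ, true_and]
  -- Number of saturated groups, those with at least `r j` zeros; each uses `r j` of the rank budget
  -- `k - 1`.
  let w : Fin s → ℕ := fun j => (Finset.univ.filter fun l => r j ≤ (Z j l).card).card
  have h3 : ∑ j, w j * r j ≤ ∑ j, ∑ l, min (Z j l).card (r j) := by
    refine Finset.sum_le_sum fun j _ => ?_
    simp only [w, Finset.card_filter, Finset.sum_mul]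
    refine Finset.sum_le_sum fun l _ => ?_
    split_ifs <;> simp [*]
  -- A group has length `r j + δ j - 1`, so at most `δ j - 1` zeros exceed the cap.
  have h4 : ∑ j, ∑ l, (Z j l).card ≤
      ∑ j, ∑ l, min (Z j l).card (r j) + ∑ j, w j * (δ j - 1) := by
    rw [← Finset.sum_add_distrib]
    refine Finset.sum_le_sum fun j _ => ?_
    simp only [w, Finset.card_filter, Finset.sum_mul]
    rw [← Finset.sum_add_distrib]
    refine Finset.sum_le_sum fun l _ => ?_
    have := Finset.card_le_univ (Z j l)
    rw [Fintype.card_fin] at this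
    split_ifs <;> omega
  have h5 : ∑ j, w j * (δ j - 1) ≤ ∑ j, greedyFill m r k σ j * (δ j - 1) := by
    refine sum_mul_le_of_greedy (m := m) (b := k - 1) (σ := σ) hord.1
      (fun i j hij => Nat.sub_le_sub_right (hord.2 hij) 1) (fun j hj => if_pos hj)
      (fun j hj => by simp [greedyFill, hj.not_gt, hj.ne']) ?_ (fun j => ?_) (by omega)
    -- One more group of class `σ` would push the greedy rank beyond `k - 1`.
    · rw [sum_greedyFill_mul]
      have := Nat.lt_div_mul_add (a := k - 1 - ∑ i ∈ Finset.Iio σ, m i * r i) (b := r σ) (hr σ)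
      omega
    · exact (Finset.card_le_univ _).trans (by simp)
  omega

end Construction

end UDLRC

theorem mainTheorem3 {K L : Type*} [Field K] [Fintype K] [Field L] [Fintype L] [Algebra K L]
    (s : ℕ) (m r δ : Fin s → ℕ) (k : ℕ)
    (hr : ∀ j, 1 ≤ r j) (hδ : ∀ j, 1 ≤ δ j)
    (hk : 1 ≤ k) (hkGab : k ≤ ∑ j, m j * r j)
    (ht : ∑ j, m j * r j ≤ Module.finrank K L)
    (hord : UDLRC.OrderedCondition r δ)
    (x : UDLRC.GabIndex m r → L) (hx : LinearIndependent K x)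
    (G : ∀ j : Fin s, Fin (m j) → Matrix (Fin (r j)) (Fin (r j + δ j - 1)) K)
    (hG : ∀ j l, UDLRC.IsMDSGenerator (G j l)) :
    Module.finrank L (UDLRC.gabidulinLRC k x G) = k ∧
    UDLRC.HasLocality (UDLRC.gabidulinLRC k x G) (fun p => p.1)
      (fun j => m j * (r j + δ j - 1)) r δ ∧
    (∃ σ : Fin s, UDLRC.IsSStar (fun j => m j * (r j + δ j - 1)) r δ k σ ∧
      ∃ d : ℕ, UDLRC.minDist (UDLRC.gabidulinLRC k x G) = (d : ℕ∞) ∧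
        (d : ℤ) = UDLRC.distBound (fun j => m j * (r j + δ j - 1)) r δ k σ) ∧
    (∀ (F : Type*) [Field F] [Fintype F]
      (C : Submodule F (Fin (∑ j, m j * (r j + δ j - 1)) → F))
      (part : Fin (∑ j, m j * (r j + δ j - 1)) → Fin s),
      Module.finrank F C = k →
      UDLRC.HasLocality C part (fun j => m j * (r j + δ j - 1)) r δ →
      UDLRC.minDist C ≤ UDLRC.minDist (UDLRC.gabidulinLRC k x G)) := by
  classical
  have hfin := UDLRC.finrank_gabidulinLRC hδ hkGab hx hG
  have hloc := UDLRC.hasLocality_gabidulinLRC (k := k) (x := x) hδ hG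
  obtain ⟨σ, hσ⟩ := UDLRC.exists_isLeast hk hkGab
  have hv := UDLRC.greedyFill_le hσ
  have hvk : ∑ j, UDLRC.greedyFill m r k σ j * r j < k := by
    have h1 := UDLRC.sum_Iio_lt hk hσ
    have h2 := Nat.div_mul_le_self (k - 1 - ∑ i ∈ Finset.Iio σ, m i * r i) (r σ)
    rw [UDLRC.sum_greedyFill_mul]
    omega
  have hcard : Fintype.card (UDLRC.SymIndex m r δ) = ∑ j, m j * (r j + δ j - 1) := by simp
  have hlow : ∀ c ∈ UDLRC.gabidulinLRC k x G, c ≠ 0 → _ := fun c hc h0 =>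
    UDLRC.card_le_hammingNorm_add (σ := σ) hr hδ hk hord hx hG hc h0
  -- The upper bound applied to the code itself yields a codeword whose weight meets the lower bound
  -- `hlow`.
  obtain ⟨c₀, hc₀, hne, hup⟩ := hloc.exists_hammingNorm_add_le hδ hv (by rwa [hfin])
  rw [hfin] at hup
  have hd : UDLRC.minDist (UDLRC.gabidulinLRC k x G) = (hammingNorm c₀ : ℕ∞) := by
    refine le_antisymm (UDLRC.minDist_le_hammingNorm hc₀ hne) (UDLRC.le_minDist_iff.2 ?_)
    intro c hc h0
    have := hlow c hc h0
    rw [Nat.cast_le]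
    omega
  have hlow₀ := hlow c₀ hc₀ hne
  refine ⟨hfin, hloc, ⟨σ, (UDLRC.isSStar_iff hr hδ).2 hσ, hammingNorm c₀, hd, ?_⟩, ?_⟩
  · rw [UDLRC.distBound_eq hr hδ hk hσ]
    omega
  · intro F _ _ C part hC hCloc
    -- The same greedy filling serves every competitor, since it depends only on `m`, `r`, `k` and
    -- `σ`.
    obtain ⟨c, hc, h0, hle⟩ := hCloc.exists_hammingNorm_add_le hδ hv (by rwa [hC])
    refine (UDLRC.minDist_le_hammingNorm hc h0).trans ?_
    rw [hC, Fintype.card_fin] at hle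
    rw [hd, Nat.cast_le]
    omega
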